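/- Let $m<n$ be non-negative integers, $p=2^m$, and let $\lambda_+,\lambda_-$ be real numbers. Let $\mathcal S^{\lambda_+,\lambda_-}_{m,n}$ be the set of states (positive semidefinite matrices of trace one) $\tau$ on $\mathbb C^{2^m}\otimes\mathbb C^{2^n}$ whose largest eigenvalue is $\lambda_+$, with multiplicity at least $\frac{p(p-1)}{2}=2^{2m-1}-2^{m-1}$, and whose smallest eigenvalue is $\lambda_-$, with multiplicity at least $\frac{p(p+1)}{2}=2^{2m-1}+2^{m-1}$. A state $\tau$ is called PPT from spectrum if for every unitary $U$ on $\mathbb C^{2^m}\otimes\mathbb C^{2^n}$ the partial transpose $(T\otimes 1)(U\tau U^\dagger)$, where $T$ is the transposition on the first factor, is positive semidefinite. Then every state $\tau\in\mathcal S^{\lambda_+,\lambda_-}_{m,n}$ satisfies $$\tau\text{ is PPT from spectrum}\iff \tfrac12(\lambda_++\lambda_-)-2^{m-1}(\lambda_+-\lambda_-)\ge 0 .$$ In particular, if $\mathcal S^{\lambda_+,\lambda_-}_{m,n}$ is non-empty, then all its states are PPT from spectrum if and only if this inequality holds. -/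

import Mathlib

open scoped ComplexOrder

/-- A (mixed) quantum state: a positive semidefinite matrix of trace one. -/
def IsState {ι : Type*} [Fintype ι] (ρ : Matrix ι ι ℂ) : Prop :=
  ρ.PosSemidef ∧ ρ.trace = 1

/-- The partial transpose `(T ⊗ 1)(ρ)`, transposing the first tensor factor. -/
def partialTranspose {α β : Type*} (ρ : Matrix (α × β) (α × β) ℂ) :
    Matrix (α × β) (α × β) ℂ :=
  Matrix.of fun x y => ρ (y.1, x.2) (x.1, y.2)

/-- `ρ` is PPT: its partial transpose is positive semidefinite. -/
def IsPPT {α β : Type*} (ρ : Matrix (α × β) (α × β) ℂ) : Prop :=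
  (partialTranspose ρ).PosSemidef

/-- `ρ` is PPT from spectrum: `U ρ U†` is PPT for every unitary `U` on the whole space. -/
def IsPPTFromSpectrum {α β : Type*} [Fintype α] [Fintype β] [DecidableEq α] [DecidableEq β]
    (ρ : Matrix (α × β) (α × β) ℂ) : Prop :=
  ∀ U ∈ Matrix.unitaryGroup (α × β) ℂ, IsPPT (U * ρ * U.conjTranspose)

/-- The degeneracy of the real number `μ` as an eigenvalue of `ρ`
(the dimension of the eigenspace; it is `0` if `μ` is not an eigenvalue). -/
noncomputable def degeneracy {ι : Type*} [Fintype ι] [DecidableEq ι]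
    (ρ : Matrix ι ι ℂ) (μ : ℝ) : ℕ :=
  Module.finrank ℂ (Module.End.eigenspace (Matrix.toEuclideanLin ρ) (μ : ℂ))

/-- `p₊ = p (p + 1) / 2`; for `p = 2 ^ m` this is `2 ^ (2 m - 1) + 2 ^ (m - 1)`. -/
def pPlus (p : ℕ) : ℕ := p * (p + 1) / 2

/-- `p₋ = p (p - 1) / 2`; for `p = 2 ^ m` this is `2 ^ (2 m - 1) - 2 ^ (m - 1)`. -/
def pMinus (p : ℕ) : ℕ := p * (p - 1) / 2

/-- The states on `ℂ^(2^m) ⊗ ℂ^(2^n)` whose largest eigenvalue is `lp`, with degeneracy at least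
`p₋`, and whose smallest eigenvalue is `lm`, with degeneracy at least `p₊`, where `p = 2 ^ m`. -/
def degenerateStates (m n : ℕ) (lp lm : ℝ) :
    Set (Matrix (Fin (2 ^ m) × Fin (2 ^ n)) (Fin (2 ^ m) × Fin (2 ^ n)) ℂ) :=
  {τ | IsState τ ∧
    IsGreatest (spectrum ℝ τ) lp ∧ pMinus (2 ^ m) ≤ degeneracy τ lp ∧
    IsLeast (spectrum ℝ τ) lm ∧ pPlus (2 ^ m) ≤ degeneracy τ lm}

open Matrix
open scoped Pointwise

/-! Put `p = 2 ^ m`. Sufficiency (`IsPPT.of_bounds`) needs only the spectral bounds: the form of the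
partial transpose at `ψ` is `∑ ⟨x_ij, ρ x_ji⟩` with `x_ij = e_j ⊗ ψ_i`. Polarizing, `ρ` is bounded
below by `lm` on `x_ij + x_ji` and above by `lp` on `x_ij - x_ji`. Necessity uses the degeneracies:
they match the dimensions of the antisymmetric and symmetric parts of `ℂ^p ⊗ ℂ^p`, so a unitary
carries `lp`- and `lm`-eigenvectors onto bases of these. A maximally entangled vector then makes the
bound an equality (`IsPPT.le_of_symmBasis`). -/

theorem partialTranspose_one {α β : Type*} [DecidableEq α] [DecidableEq β] :
    partialTranspose (1 : Matrix (α × β) (α × β) ℂ) = 1 := by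
  ext x y
  simp only [partialTranspose, Matrix.of_apply, Matrix.one_apply, Prod.ext_iff]
  congr 1
  simp [eq_comm]

theorem Matrix.IsHermitian.partialTranspose {α β : Type*} {ρ : Matrix (α × β) (α × β) ℂ}
    (h : ρ.IsHermitian) : (partialTranspose ρ).IsHermitian := by
  ext x y
  exact h.apply _ _

/-- The vector `e_j ⊗ ψ_i`, where `ψ_i` is the `i`-th block of `ψ`. -/
def blockShift {α β : Type*} [DecidableEq α] (ψ : α × β → ℂ) (i j : α) : α × β → ℂ :=
  fun a => if a.1 = j then ψ (i, a.2) else 0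

/-! ### Sufficiency: the partial transpose as a quadratic form. -/

section

variable {α β : Type*} [Fintype α] [Fintype β] [DecidableEq α]

theorem dotProduct_blockShift_mulVec (ρ : Matrix (α × β) (α × β) ℂ) (ψ : α × β → ℂ)
    (i j k l : α) :
    star (blockShift ψ i j) ⬝ᵥ ρ *ᵥ blockShift ψ k l =
      ∑ b, ∑ d, star (ψ (i, b)) * (ρ (j, b) (l, d) * ψ (k, d)) := by
  simp only [dotProduct, mulVec, blockShift, Pi.star_apply, Fintype.sum_prod_type, mul_ite,
    mul_zero, apply_ite star, star_zero, ite_mul, zero_mul]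
  rw [Finset.sum_eq_single j (by simp +contextual) (by simp)]
  refine Finset.sum_congr rfl fun b _ => ?_
  rw [if_pos rfl, Finset.sum_eq_single l (by simp +contextual) (by simp), Finset.mul_sum]
  simp

theorem dotProduct_partialTranspose_mulVec (ρ : Matrix (α × β) (α × β) ℂ) (ψ : α × β → ℂ) :
    star ψ ⬝ᵥ partialTranspose ρ *ᵥ ψ =
      ∑ i, ∑ j, star (blockShift ψ i j) ⬝ᵥ ρ *ᵥ blockShift ψ j i := by
  simp only [dotProduct_blockShift_mulVec]
  simp only [dotProduct, mulVec, partialTranspose, Pi.star_apply, Fintype.sum_prod_type,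
    Finset.mul_sum, Matrix.of_apply]
  exact Finset.sum_congr rfl fun i _ => Finset.sum_comm

theorem sum_dotProduct_blockShift (ψ : α × β → ℂ) :
    ∑ i, ∑ j, star (blockShift ψ i j) ⬝ᵥ blockShift ψ i j =
      Fintype.card α * (star ψ ⬝ᵥ ψ) := by
  classical
  have h (i j : α) : star (blockShift ψ i j) ⬝ᵥ blockShift ψ i j =
      ∑ b, star (ψ (i, b)) * ψ (i, b) := by
    have := dotProduct_blockShift_mulVec (1 : Matrix (α × β) (α × β) ℂ) ψ i j i j
    simpa [Matrix.one_apply] using this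
  simp only [h, Finset.sum_const, Finset.card_univ, nsmul_eq_mul, ← Finset.mul_sum]
  simp [dotProduct, Fintype.sum_prod_type]

variable [DecidableEq β]

theorem IsPPT.of_bounds {ρ : Matrix (α × β) (α × β) ℂ} {lp lm : ℝ} (hρ : ρ.IsHermitian)
    (hp : ((lp : ℂ) • 1 - ρ).PosSemidef) (hm : (ρ - (lm : ℂ) • 1).PosSemidef)
    (h : 0 ≤ (lp + lm) - Fintype.card α * (lp - lm)) : IsPPT ρ := by
  refine Matrix.PosSemidef.of_dotProduct_mulVec_nonneg hρ.partialTranspose fun ψ => ?_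
  have polar (A : Matrix (α × β) (α × β) ℂ) (x y : α × β → ℂ) :
      star (x + y) ⬝ᵥ A *ᵥ (x + y) = (star x ⬝ᵥ A *ᵥ x + star y ⬝ᵥ A *ᵥ y) +
        (star x ⬝ᵥ A *ᵥ y + star y ⬝ᵥ A *ᵥ x) ∧
      star (x - y) ⬝ᵥ A *ᵥ (x - y) = (star x ⬝ᵥ A *ᵥ x + star y ⬝ᵥ A *ᵥ y) -
        (star x ⬝ᵥ A *ᵥ y + star y ⬝ᵥ A *ᵥ x) := by
    constructor <;>
    simp only [star_add, star_sub, mulVec_add, mulVec_sub, add_dotProduct, sub_dotProduct,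
      dotProduct_add, dotProduct_sub] <;> ring
  have swap (f : α → α → ℂ) : ∑ i, ∑ j, (f i j + f j i) = 2 * ∑ i, ∑ j, f i j := by
    simp only [Finset.sum_add_distrib]
    rw [Finset.sum_comm (f := fun i j => f j i)]
    ring
  set x := blockShift ψ with hx
  have plus (A : Matrix (α × β) (α × β) ℂ) :
      ∑ i, ∑ j, star (x i j + x j i) ⬝ᵥ A *ᵥ (x i j + x j i) =
        2 * (∑ i, ∑ j, star (x i j) ⬝ᵥ A *ᵥ x i j) +
        2 * (star ψ ⬝ᵥ partialTranspose A *ᵥ ψ) := by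
    rw [dotProduct_partialTranspose_mulVec, ← swap, ← swap]
    simp only [(polar A _ _).1, Finset.sum_add_distrib, hx]
  have minus (A : Matrix (α × β) (α × β) ℂ) :
      ∑ i, ∑ j, star (x i j - x j i) ⬝ᵥ A *ᵥ (x i j - x j i) =
        2 * (∑ i, ∑ j, star (x i j) ⬝ᵥ A *ᵥ x i j) -
        2 * (star ψ ⬝ᵥ partialTranspose A *ᵥ ψ) := by
    rw [dotProduct_partialTranspose_mulVec, ← swap, ← swap]
    simp only [(polar A _ _).2, Finset.sum_add_distrib, Finset.sum_sub_distrib, hx]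
  have hplus : (lm : ℂ) * ∑ i, ∑ j, star (x i j + x j i) ⬝ᵥ (1 : Matrix (α × β) (α × β) ℂ) *ᵥ
        (x i j + x j i) ≤ ∑ i, ∑ j, star (x i j + x j i) ⬝ᵥ ρ *ᵥ (x i j + x j i) := by
    simp only [Finset.mul_sum]
    refine Finset.sum_le_sum fun i _ => Finset.sum_le_sum fun j _ => ?_
    have := hm.dotProduct_mulVec_nonneg (x i j + x j i)
    rwa [sub_mulVec, dotProduct_sub, smul_mulVec, dotProduct_smul, sub_nonneg, smul_eq_mul] at this
  have hminus : ∑ i, ∑ j, star (x i j - x j i) ⬝ᵥ ρ *ᵥ (x i j - x j i) ≤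
      (lp : ℂ) * ∑ i, ∑ j, star (x i j - x j i) ⬝ᵥ (1 : Matrix (α × β) (α × β) ℂ) *ᵥ
        (x i j - x j i) := by
    simp only [Finset.mul_sum]
    refine Finset.sum_le_sum fun i _ => Finset.sum_le_sum fun j _ => ?_
    have := hp.dotProduct_mulVec_nonneg (x i j - x j i)
    rwa [sub_mulVec, dotProduct_sub, smul_mulVec, dotProduct_smul, sub_nonneg, smul_eq_mul] at this
  have hN := sum_dotProduct_blockShift ψ
  -- Taken at the identity matrix, `plus` and `minus` give the total squared norms `2(p ± 1)‖ψ‖²`,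
  -- where `p` is the cardinality of `α`. Adding the two bounds cancels the diagonal terms of `ρ`.
  rw [plus, plus] at hplus
  rw [minus, minus] at hminus
  simp only [partialTranspose_one, one_mulVec, ← hx] at hplus hminus hN
  rw [hN] at hplus hminus
  have h0 : (0 : ℂ) ≤ star ψ ⬝ᵥ ψ := dotProduct_star_self_nonneg ψ
  have hc : (0 : ℂ) ≤ ((lp + lm - Fintype.card α * (lp - lm) : ℝ) : ℂ) := by exact_mod_cast h
  have key := add_le_add hplus hminus
  have hmul := mul_nonneg hc h0
  push_cast at hmul
  set D := star ψ ⬝ᵥ partialTranspose ρ *ᵥ ψ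
  have h4 : (0 : ℂ) ≤ 4 * D := by
    rw [← sub_nonneg] at key
    convert add_nonneg key (add_nonneg hmul hmul) using 1
    ring
  have : D = (1 / 4 : ℂ) * (4 * D) := by ring
  rw [this]
  exact mul_nonneg (by norm_num [Complex.le_def]) h4

end

section

variable {ι : Type*} [Fintype ι] [DecidableEq ι]

theorem Matrix.IsHermitian.posSemidef_smul_one_sub {τ : Matrix ι ι ℂ} (hτ : τ.IsHermitian)
    {l : ℝ} (h : l ∈ upperBounds (spectrum ℝ τ)) : ((l : ℂ) • 1 - τ).PosSemidef := by
  have hH : ((l : ℂ) • (1 : Matrix ι ι ℂ) - τ).IsHermitian := by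
    refine IsHermitian.sub ?_ hτ
    simp [Matrix.IsHermitian, conjTranspose_smul]
  rw [hH.posSemidef_iff_eigenvalues_nonneg]
  intro i
  have := hH.eigenvalues_mem_spectrum_real i
  have e : (l : ℂ) • (1 : Matrix ι ι ℂ) = algebraMap ℝ _ l := by
    ext a b; simp [Matrix.algebraMap_matrix_apply, Matrix.one_apply]
  have hs : spectrum ℝ ((l : ℂ) • 1 - τ) = ({l} : Set ℝ) - spectrum ℝ τ := by
    rw [e, spectrum.singleton_sub_eq]
  rw [hs] at this
  obtain ⟨a, rfl, b, hb, hab⟩ := this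
  simpa [← hab] using h hb

theorem Matrix.IsHermitian.posSemidef_sub_smul_one {τ : Matrix ι ι ℂ} (hτ : τ.IsHermitian)
    {l : ℝ} (h : l ∈ lowerBounds (spectrum ℝ τ)) : (τ - (l : ℂ) • 1).PosSemidef := by
  have := hτ.neg.posSemidef_smul_one_sub (l := -l) ?_
  · simpa [sub_eq_add_neg, add_comm] using this
  · rw [← spectrum.neg_eq]
    intro x hx
    have := h hx
    linarith

end

/-! ### Moving eigenvectors by a unitary. -/

section

variable {ι κ : Type*} [Fintype ι]

theorem exists_orthonormalBasis_apply_embedding {s : κ → EuclideanSpace ℂ ι}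
    (hs : Orthonormal ℂ s) (e : κ ↪ ι) :
    ∃ b : OrthonormalBasis ι ℂ (EuclideanSpace ℂ ι), ∀ k, b (e k) = s k := by
  have hr : Orthonormal ℂ ((Set.range e).domRestrict (Function.extend e s 0)) := by
    convert hs.comp (Equiv.ofInjective e e.injective).symm (Equiv.injective _)
    ext1 ⟨_, k, rfl⟩
    simp [e.injective.extend_apply]
  obtain ⟨b, hb⟩ := hr.exists_orthonormalBasis_extension_of_card_eq (by simp)
  exact ⟨b, fun k => by rw [hb _ ⟨k, rfl⟩, e.injective.extend_apply]⟩

variable [DecidableEq ι] [Fintype κ]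

/-- Both families extend to orthonormal bases along the same embedding of indices, and the change of
basis is unitary. -/
theorem exists_unitary_mulVec_eq {s v : κ → EuclideanSpace ℂ ι} (hs : Orthonormal ℂ s)
    (hv : Orthonormal ℂ v) :
    ∃ U ∈ Matrix.unitaryGroup ι ℂ, ∀ k, U *ᵥ (s k).ofLp = (v k).ofLp := by
  obtain ⟨e⟩ : Nonempty (κ ↪ ι) := by
    apply Function.Embedding.nonempty_of_card_le
    simpa using hs.linearIndependent.fintype_card_le_finrank
  obtain ⟨b, hb⟩ := exists_orthonormalBasis_apply_embedding hs e
  obtain ⟨b', hb'⟩ := exists_orthonormalBasis_apply_embedding hv e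
  let M (c : OrthonormalBasis ι ℂ (EuclideanSpace ℂ ι)) : Matrix ι ι ℂ :=
    (EuclideanSpace.basisFun ι ℂ).toBasis.toMatrix c
  have hM (c) : M c ∈ Matrix.unitaryGroup ι ℂ :=
    OrthonormalBasis.toMatrix_orthonormalBasis_mem_unitary _ _
  have hcol (c) (i) : M c *ᵥ Pi.single i 1 = (c i).ofLp := by
    ext j
    simp [M, Module.Basis.toMatrix_apply]
  refine ⟨M b' * star (M b), mul_mem (hM b') (Unitary.star_mem (hM b)), fun k => ?_⟩
  rw [← hb, ← hb', ← hcol, ← hcol, mulVec_mulVec, mul_assoc,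
    Matrix.mem_unitaryGroup_iff'.mp (hM b), mul_one]

theorem exists_orthonormal_eigenvectors {τ : Matrix ι ι ℂ} (hτ : τ.IsHermitian) {lp lm : ℝ}
    (hne : lp ≠ lm) (P : κ → Prop) [DecidablePred P]
    (hp : Fintype.card {k // P k} ≤ degeneracy τ lp)
    (hm : Fintype.card {k // ¬ P k} ≤ degeneracy τ lm) :
    ∃ s : κ → EuclideanSpace ℂ ι, Orthonormal ℂ s ∧
      ∀ k, τ *ᵥ (s k).ofLp = ((if P k then lp else lm : ℝ) : ℂ) • (s k).ofLp := by
  let E (l : ℝ) := Module.End.eigenspace (Matrix.toEuclideanLin τ) (l : ℂ)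
  have hE (l : ℝ) (x : E l) : τ *ᵥ (x : EuclideanSpace ℂ ι).ofLp =
      (l : ℂ) • (x : EuclideanSpace ℂ ι).ofLp := by
    have := Module.End.mem_eigenspace_iff.mp x.2
    exact congrArg WithLp.ofLp this
  have horth {l l' : ℝ} (h : l ≠ l') (x : E l) (y : E l') :
      inner ℂ (x : EuclideanSpace ℂ ι) (y : EuclideanSpace ℂ ι) = 0 :=
    (Matrix.isSymmetric_toEuclideanLin_iff.mpr hτ).orthogonalFamily_eigenspaces
      (Complex.ofReal_injective.ne h) x y
  obtain ⟨f⟩ : Nonempty ({k // P k} ↪ Fin (Module.finrank ℂ (E lp))) :=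
    Function.Embedding.nonempty_of_card_le ((Fintype.card_fin _).symm ▸ hp)
  obtain ⟨g⟩ : Nonempty ({k // ¬ P k} ↪ Fin (Module.finrank ℂ (E lm))) :=
    Function.Embedding.nonempty_of_card_le ((Fintype.card_fin _).symm ▸ hm)
  let bp := stdOrthonormalBasis ℂ (E lp)
  let bm := stdOrthonormalBasis ℂ (E lm)
  let s : κ → EuclideanSpace ℂ ι := fun k =>
    if h : P k then (bp (f ⟨k, h⟩) : EuclideanSpace ℂ ι) else bm (g ⟨k, h⟩)
  refine ⟨s, ?_, fun k => ?_⟩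
  · classical
    rw [orthonormal_iff_ite]
    intro k l
    by_cases hk : P k <;> by_cases hl : P l <;> simp only [s, hk, hl, dite_true, dite_false]
    · rw [← Submodule.coe_inner, orthonormal_iff_ite.mp bp.orthonormal]
      simp
    · rw [horth hne, if_neg]
      rintro rfl; exact hl hk
    · rw [horth hne.symm, if_neg]
      rintro rfl; exact hk hl
    · rw [← Submodule.coe_inner, orthonormal_iff_ite.mp bm.orthonormal]
      simp
  · by_cases hk : P k <;> simp only [s, hk, dite_true, dite_false, if_true, if_false] <;> apply hE

end

theorem card_fin_prod_lt (p : ℕ) :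
    Fintype.card {x : Fin p × Fin p // x.1 < x.2} = pMinus p ∧
    Fintype.card {x : Fin p × Fin p // ¬ x.1 < x.2} = pPlus p := by
  have hsum : Fintype.card {x : Fin p × Fin p // x.1 < x.2} * 2 = p * (p - 1) := by
    rw [Fintype.card_subtype]
    have hswap : (Finset.univ.filter fun x : Fin p × Fin p => x.2 < x.1).card =
        (Finset.univ.filter fun x : Fin p × Fin p => x.1 < x.2).card :=
      Finset.card_equiv (Equiv.prodComm _ _) (by simp)
    have hunion : (Finset.univ : Finset (Fin p)).offDiag =
        (Finset.univ.filter fun x : Fin p × Fin p => x.1 < x.2) ∪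
        (Finset.univ.filter fun x : Fin p × Fin p => x.2 < x.1) := by
      ext x
      simp [lt_or_lt_iff_ne]
    have hcard := congrArg Finset.card hunion
    rw [Finset.card_union_of_disjoint, hswap, Finset.offDiag_card] at hcard
    · simp only [Finset.card_univ, Fintype.card_fin] at hcard
      rw [Nat.mul_sub, mul_one, hcard, mul_two]
    · rw [Finset.disjoint_filter]
      exact fun x _ h => h.asymm
  have h1 : Fintype.card {x : Fin p × Fin p // x.1 < x.2} = pMinus p := by
    rw [pMinus]; omega
  refine ⟨h1, ?_⟩
  rw [Fintype.card_subtype_compl, Fintype.card_prod, Fintype.card_fin, pPlus]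
  rcases p with _ | p
  · simp
  · have e1 : (p + 1) * (p + 1 - 1) = p * p + p := by rw [Nat.add_sub_cancel]; ring
    have e2 : (p + 1) * (p + 1 + 1) = p * p + 3 * p + 2 := by ring
    have e3 : (p + 1) * (p + 1) = p * p + 2 * p + 1 := by ring
    rw [e1] at hsum
    rw [e2, e3]
    omega

/-! ### Necessity: the symmetric and antisymmetric test state. -/

section

variable {α β : Type*} [Fintype α] [Fintype β] [LinearOrder α] [DecidableEq β]

/-- An orthonormal basis of `ℂ^α ⊗ ℂ^α`, embedded into `ℂ^α ⊗ ℂ^β` along `f`: antisymmetric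
vectors at the indices `i < j`, symmetric ones at the others. -/
noncomputable def symmBasis (f : α ↪ β) (x : α × α) : EuclideanSpace ℂ (α × β) :=
  if x.1 < x.2 then
    ((√2)⁻¹ : ℂ) • (EuclideanSpace.single (x.1, f x.2) 1 - EuclideanSpace.single (x.2, f x.1) 1)
  else if x.2 < x.1 then
    ((√2)⁻¹ : ℂ) • (EuclideanSpace.single (x.1, f x.2) 1 + EuclideanSpace.single (x.2, f x.1) 1)
  else EuclideanSpace.single (x.1, f x.2) 1

theorem orthonormal_symmBasis (f : α ↪ β) : Orthonormal ℂ (symmBasis f) := by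
  rw [orthonormal_iff_ite]
  rintro ⟨i, j⟩ ⟨k, l⟩
  have hc : ((√2 : ℝ) : ℂ)⁻¹ * ((√2 : ℝ) : ℂ)⁻¹ = 1 / 2 := by
    rw [← mul_inv, ← Complex.ofReal_mul, Real.mul_self_sqrt (by norm_num)]
    norm_num
  have he (i j k l : α) : inner ℂ (EuclideanSpace.single (i, f j) (1 : ℂ))
      (EuclideanSpace.single (k, f l) (1 : ℂ)) = if i = k ∧ j = l then 1 else 0 := by
    simp [EuclideanSpace.inner_single_left]
  rcases lt_trichotomy i j with hij | hij | hij <;>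
  rcases lt_trichotomy k l with hkl | hkl | hkl <;>
  simp only [symmBasis, hij, hkl, hij.not_gt, hkl.not_gt, if_true, if_false, lt_irrefl,
    inner_smul_left, inner_smul_right, inner_sub_left, inner_sub_right, inner_add_left,
    inner_add_right, he, map_inv₀, Complex.conj_ofReal, Prod.mk.injEq] <;>
  grind

/-- On the embedded `ℂ^α ⊗ ℂ^α`, `ρ` acts as `(lp + lm)/2 · 1 - (lp - lm)/2 · F`, with `F` the flip
of the factors. -/
theorem apply_swap_of_symmBasis_eigenvectors {ρ : Matrix (α × β) (α × β) ℂ} (f : α ↪ β) {lp lm : ℝ}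
    (h : ∀ x : α × α, ρ *ᵥ (symmBasis f x).ofLp =
      ((if x.1 < x.2 then lp else lm : ℝ) : ℂ) • (symmBasis f x).ofLp) (i j : α) :
    ρ (j, f i) (i, f j) = (lp + lm) / 2 * (if i = j then 1 else 0) + (lm - lp) / 2 := by
  have hc : ((√2 : ℝ) : ℂ)⁻¹ ≠ 0 := by simp
  have main (i j : α) (hij : i < j) (a : α × β) :
      ρ a (i, f j) - ρ a (j, f i) = lp * ((Pi.single (i, f j) 1 : α × β → ℂ) a -
        (Pi.single (j, f i) 1 : α × β → ℂ) a) ∧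
      ρ a (j, f i) + ρ a (i, f j) = lm * ((Pi.single (j, f i) 1 : α × β → ℂ) a +
        (Pi.single (i, f j) 1 : α × β → ℂ) a) := by
    have h1 := congrFun (h (i, j)) a
    have h2 := congrFun (h (j, i)) a
    simp only [symmBasis, hij, hij.not_gt, if_true, if_false, WithLp.ofLp_smul, WithLp.ofLp_sub,
      WithLp.ofLp_add, PiLp.ofLp_single, mulVec_smul, mulVec_sub, mulVec_add,
      mulVec_single_one, Pi.smul_apply, Pi.sub_apply, Pi.add_apply, col_apply,
      smul_eq_mul] at h1 h2
    constructor
    · exact mul_left_cancel₀ hc (by linear_combination h1)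
    · exact mul_left_cancel₀ hc (by linear_combination h2)
  rcases lt_trichotomy i j with hij | rfl | hij
  · have := main i j hij (j, f i)
    simp [hij.ne, hij.ne'] at this
    rw [if_neg hij.ne]
    linear_combination (this.1 + this.2) / 2
  · have h1 := congrFun (h (i, i)) (i, f i)
    simp [symmBasis] at h1
    rw [h1]
    simp
    ring
  · have := main j i hij (j, f i)
    simp [hij.ne, hij.ne'] at this
    rw [if_neg hij.ne']
    linear_combination (this.2 - this.1) / 2

theorem IsPPT.le_of_symmBasis {ρ : Matrix (α × β) (α × β) ℂ} (hρ : IsPPT ρ) [Nonempty α]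
    (f : α ↪ β) {lp lm : ℝ} (h : ∀ x : α × α, ρ *ᵥ (symmBasis f x).ofLp =
      ((if x.1 < x.2 then lp else lm : ℝ) : ℂ) • (symmBasis f x).ofLp) :
    0 ≤ (lp + lm) - Fintype.card α * (lp - lm) := by
  -- The unnormalized maximally entangled vector: partial transposition turns the flip into the
  -- projector onto its line, up to a factor.
  let ψ : α × β → ℂ := ∑ i, Pi.single (i, f i) 1
  have h0 := hρ.dotProduct_mulVec_nonneg ψ
  have hsum : star ψ ⬝ᵥ partialTranspose ρ *ᵥ ψ = ∑ i, ∑ j, ρ (j, f i) (i, f j) := by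
    have hstar : star ψ = ∑ i, Pi.single (i, f i) 1 := by
      simp [ψ, star_sum]
    rw [hstar]
    rw [Finset.sum_comm]
    simp only [ψ, mulVec_sum, sum_dotProduct, dotProduct_sum, mulVec_single_one,
      single_one_dotProduct, col_apply, partialTranspose, of_apply]
  rw [hsum] at h0
  simp only [apply_swap_of_symmBasis_eigenvectors f h, Finset.sum_add_distrib, ← Finset.mul_sum,
    Finset.sum_ite_eq, Finset.mem_univ, if_true, Finset.sum_const, Finset.card_univ,
    nsmul_eq_mul, mul_one] at h0
  have h1 : (0 : ℝ) ≤ Fintype.card α * ((lp + lm) / 2) +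
      Fintype.card α * (Fintype.card α * ((lm - lp) / 2)) := by exact_mod_cast h0
  have hcard : (0 : ℝ) < Fintype.card α := by exact_mod_cast Fintype.card_pos
  refine nonneg_of_mul_nonneg_right (a := (Fintype.card α : ℝ) / 2) ?_ (by positivity)
  linarith

end

/-- Criterion for PPT from spectrum when the extremal eigenvalues are sufficiently degenerate. -/
theorem isPPTFromSpectrum_iff_of_degeneracy {p q : ℕ} (hp : 0 < p) (hpq : p ≤ q)
    {τ : Matrix (Fin p × Fin q) (Fin p × Fin q) ℂ} (hτ : τ.PosSemidef) {lp lm : ℝ}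
    (hlp : IsGreatest (spectrum ℝ τ) lp) (hdp : pMinus p ≤ degeneracy τ lp)
    (hlm : IsLeast (spectrum ℝ τ) lm) (hdm : pPlus p ≤ degeneracy τ lm) :
    IsPPTFromSpectrum τ ↔ 0 ≤ (lp + lm) - p * (lp - lm) := by
  constructor
  · intro h
    -- If the eigenvalues coincide, the two eigenspaces are not orthogonal, but the inequality
    -- reduces to `0 ≤ lp`.
    by_cases hne : lp = lm
    · subst hne
      have : 0 ≤ lp := by
        have := hlp.1
        rw [hτ.1.spectrum_real_eq_range_eigenvalues] at this
        obtain ⟨i, rfl⟩ := this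
        exact hτ.eigenvalues_nonneg i
      simpa using this
    · have : Nonempty (Fin p) := ⟨⟨0, hp⟩⟩
      let f : Fin p ↪ Fin q := Fin.castLEEmb hpq
      obtain ⟨s, hs, hse⟩ := exists_orthonormal_eigenvectors hτ.1 hne
        (fun x : Fin p × Fin p => x.1 < x.2) ((card_fin_prod_lt p).1.trans_le hdp)
        ((card_fin_prod_lt p).2.trans_le hdm)
      obtain ⟨U, hU, hUs⟩ := exists_unitary_mulVec_eq hs (orthonormal_symmBasis f)
      have := (h U hU).le_of_symmBasis f (lp := lp) (lm := lm) fun x => by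
        have hinv : U.conjTranspose *ᵥ (U *ᵥ (s x).ofLp) = (s x).ofLp := by
          rw [mulVec_mulVec, ← star_eq_conjTranspose, Matrix.mem_unitaryGroup_iff'.mp hU,
            one_mulVec]
        rw [← hUs, ← mulVec_mulVec, hinv, ← mulVec_mulVec, hse, mulVec_smul]
      simpa using this
  · intro h U hU
    have hU1 : U * U.conjTranspose = 1 := Matrix.mem_unitaryGroup_iff.mp hU
    refine IsPPT.of_bounds (lp := lp) (lm := lm)
      (isHermitian_mul_mul_conjTranspose U hτ.1) ?_ ?_ (by simpa using h)
    · have := (hτ.1.posSemidef_smul_one_sub hlp.2).mul_mul_conjTranspose_same U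
      simpa [mul_sub, sub_mul, hU1] using this
    · have := (hτ.1.posSemidef_sub_smul_one hlm.2).mul_mul_conjTranspose_same U
      simpa [mul_sub, sub_mul, hU1] using this

theorem mainTheorem2 (m n : ℕ) (hmn : m < n) (lp lm : ℝ) :
    (∀ τ ∈ degenerateStates m n lp lm,
      (IsPPTFromSpectrum τ ↔
        0 ≤ (1 / 2 : ℝ) * (lp + lm) - (2 : ℝ) ^ ((m : ℤ) - 1) * (lp - lm))) ∧
    ((degenerateStates m n lp lm).Nonempty →
      ((∀ τ ∈ degenerateStates m n lp lm, IsPPTFromSpectrum τ) ↔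
        0 ≤ (1 / 2 : ℝ) * (lp + lm) - (2 : ℝ) ^ ((m : ℤ) - 1) * (lp - lm))) := by
  have key : ∀ τ ∈ degenerateStates m n lp lm,
      (IsPPTFromSpectrum τ ↔
        0 ≤ (1 / 2 : ℝ) * (lp + lm) - (2 : ℝ) ^ ((m : ℤ) - 1) * (lp - lm)) := by
    rintro τ ⟨⟨hτ, -⟩, hlp, hdp, hlm, hdm⟩
    rw [isPPTFromSpectrum_iff_of_degeneracy (by positivity)
      (Nat.pow_le_pow_right two_pos hmn.le) hτ hlp hdp hlm hdm,
      zpow_sub_one₀ two_ne_zero, zpow_natCast]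
    push_cast
    constructor <;> intro h <;> linarith
  refine ⟨key, fun ⟨τ, hτ⟩ => ⟨fun h => (key τ hτ).mp (h τ hτ), fun h σ hσ => (key σ hσ).mpr h⟩⟩
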